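/- Let $n\geq 1$, $N=\{1,\dots,n\}$, and let $\mathfrak S_n$ be the set of permutations of $N$. Let $\nu:2^N\to[0,1]$ be a game on $N$, i.e. a set function with $\nu(\varnothing)=0$. For $\sigma\in\mathfrak S_n$ and $0\leq i\leq n$ put $\nu_i^\sigma:=\nu(\{\sigma(1),\dots,\sigma(i)\})$. The discrete Choquet integral of $\mathbf x\in\mathbb R^n$ with respect to $\nu$ is $$C_\nu(\mathbf x):=\sum_{i=1}^n(\nu_i^\sigma-\nu_{i-1}^\sigma)\,x_{\sigma(i)},$$ where $\sigma\in\mathfrak S_n$ is any permutation such that $x_{\sigma(1)}\geq\cdots\geq x_{\sigma(n)}$ (the value does not depend on the choice of $\sigma$). Let $X_1,\dots,X_n$ be independent random variables with the standard exponential distribution (c.d.f. $F(x)=1-e^{-x}$ for $x\geq 0$). Assume that, for every $\sigma\in\mathfrak S_n$, $\nu_i^\sigma/i\neq\nu_k^\sigma/k$ whenever $i,k\in N$, $i\neq k$, and that $\nu_i^\sigma/i>0$ for all $i\in N$. Then $Y_\nu:=C_\nu(X_1,\dots,X_n)$ has a probability density function with respect to Lebesgue measure on $\mathbb R$, given (up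 to almost everywhere equality) by the nonnegative function $$f_\nu(y)=\frac1{n!}\sum_{\sigma\in\mathfrak S_n}\sum_{i=1}^n\frac{(\nu_i^\sigma/i)^{n-2}}{\prod_{k\in N,\,k\neq i}(\nu_i^\sigma/i-\nu_k^\sigma/k)}\exp\left(-\frac{y}{\nu_i^\sigma/i}\right)\quad\text{for }y\geq 0,$$ and $f_\nu(y)=0$ for $y<0$. -/

import Mathlib

open MeasureTheory ProbabilityTheory

/-- A game on `N = {1, …, n}` (modelled by `Fin n`): a set function `2^N → [0, 1]` vanishing at the
empty set. -/
structure ChoquetGame (n : ℕ) where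
  /-- The underlying set function. -/
  toFun : Finset (Fin n) → ℝ
  mem_unit : ∀ S, toFun S ∈ Set.Icc (0 : ℝ) 1
  map_empty : toFun ∅ = 0

namespace ChoquetGame

variable {n : ℕ}

/-- `ν_i^σ = ν({σ(1), …, σ(i)})` for `0 ≤ i ≤ n`. The 1-based position `k` is the element of `Fin n`
with value `k - 1`, so the first `i` positions are those with value `< i`. -/
def partialValue (ν : ChoquetGame n) (σ : Equiv.Perm (Fin n)) (i : ℕ) : ℝ :=
  ν.toFun ((Finset.univ.filter fun j : Fin n => (j : ℕ) < i).image σ)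

/-- `p_i^{ν,σ} = ν_i^σ - ν_{i-1}^σ`, where `i : Fin n` stands for the 1-based position `i + 1`. -/
def increment (ν : ChoquetGame n) (σ : Equiv.Perm (Fin n)) (i : Fin n) : ℝ :=
  ν.partialValue σ ((i : ℕ) + 1) - ν.partialValue σ (i : ℕ)

/-- The ratio `ν_i^σ / i`, where `i : Fin n` stands for the 1-based position `i + 1`. -/
noncomputable def ratio (ν : ChoquetGame n) (σ : Equiv.Perm (Fin n)) (i : Fin n) : ℝ :=
  ν.partialValue σ ((i : ℕ) + 1) / ((i : ℝ) + 1)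

end ChoquetGame

/-- A permutation `σ` such that `x_{σ(1)} ≥ ⋯ ≥ x_{σ(n)}`. -/
noncomputable def decreasingPerm {n : ℕ} (x : Fin n → ℝ) : Equiv.Perm (Fin n) :=
  Tuple.sort (fun i => OrderDual.toDual (x i))

theorem antitone_comp_decreasingPerm {n : ℕ} (x : Fin n → ℝ) :
    Antitone (x ∘ decreasingPerm x) := fun _ _ hij =>
  Tuple.monotone_sort (fun i => OrderDual.toDual (x i)) hij

/-- The discrete Choquet integral `C_ν(x) = ∑ i, p_i^{ν,σ} x_{σ(i)}` where `σ` satisfies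
`x_{σ(1)} ≥ ⋯ ≥ x_{σ(n)}`. The value is the same for every such `σ`, see `choquet_eq`. -/
noncomputable def choquet {n : ℕ} (ν : ChoquetGame n) (x : Fin n → ℝ) : ℝ :=
  ∑ i : Fin n, ν.increment (decreasingPerm x) i * x (decreasingPerm x i)

/-- At a strict descent, the first positions form an upper level set of `x`. -/
theorem image_first_eq {n : ℕ} {x : Fin n → ℝ} {σ : Equiv.Perm (Fin n)} (hσ : Antitone (x ∘ σ))
    (i : ℕ) (h0 : i < n) (h1 : i + 1 < n) (hlt : x (σ ⟨i + 1, h1⟩) < x (σ ⟨i, h0⟩)) :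
    (Finset.univ.filter fun j : Fin n => (j : ℕ) < i + 1).image σ =
      Finset.univ.filter fun j : Fin n => x (σ ⟨i, h0⟩) ≤ x j := by
  ext j
  simp only [Finset.mem_image, Finset.mem_filter, Finset.mem_univ, true_and]
  constructor
  · rintro ⟨k, hk, rfl⟩
    exact hσ (show k ≤ ⟨i, h0⟩ from Nat.lt_succ_iff.mp hk)
  · intro hj
    refine ⟨σ.symm j, ?_, by simp⟩
    by_contra hk
    have h2 : (⟨i + 1, h1⟩ : Fin n) ≤ σ.symm j := not_lt.mp hk
    have h3 := hσ h2
    simp only [Function.comp_apply, Equiv.apply_symm_apply] at h3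
    linarith

/-- The Choquet integral may be computed with any permutation that sorts `x` decreasingly. -/
theorem choquet_eq {n : ℕ} (ν : ChoquetGame n) (x : Fin n → ℝ) (σ : Equiv.Perm (Fin n))
    (hσ : Antitone (x ∘ σ)) :
    choquet ν x = ∑ i : Fin n, ν.increment σ i * x (σ i) := by
  have hτ := antitone_comp_decreasingPerm x
  unfold choquet
  set τ := decreasingPerm x
  have hxy : x ∘ τ = x ∘ σ :=
    Tuple.unique_antitone hτ hσ
  have hp : ∀ i, x (τ i) = x (σ i) := fun i => congrFun hxy i
  rw [← sub_eq_zero, ← Finset.sum_sub_distrib]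
  let y : ℕ → ℝ := fun i => if h : i < n then x (σ ⟨i, h⟩) else 0
  let d : ℕ → ℝ := fun i => ν.partialValue τ i - ν.partialValue σ i
  have d0 : d 0 = 0 := by simp [d, ChoquetGame.partialValue]
  have dn : d n = 0 := by simp [d, ChoquetGame.partialValue]
  have key : ∀ i ∈ Finset.range n,
      (d (i + 1) - d i) * y i = d (i + 1) * y (i + 1) - d i * y i := by
    intro i hi
    have h0 : i < n := Finset.mem_range.mp hi
    have : d (i + 1) * (y i - y (i + 1)) = 0 := by
      by_cases h1 : i + 1 < n
      · rcases (hσ (show (⟨i, h0⟩ : Fin n) ≤ ⟨i + 1, h1⟩ from Nat.le_succ i)).lt_or_eq with h | h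
        · have hd : d (i + 1) = 0 := by
            have h' : x (τ ⟨i + 1, h1⟩) < x (τ ⟨i, h0⟩) := by rw [hp, hp]; exact h
            simp only [d, ChoquetGame.partialValue]
            rw [image_first_eq hσ i h0 h1 h, image_first_eq hτ i h0 h1 h', hp, sub_self]
          rw [hd, zero_mul]
        · have : y i = y (i + 1) := by simpa [y, h0, h1] using h.symm
          rw [this, sub_self, mul_zero]
      · have : i + 1 = n := by omega
        rw [this, dn, zero_mul]
    linarith
  calc ∑ i : Fin n, (ν.increment τ i * x (τ i) - ν.increment σ i * x (σ i))
      = ∑ i : Fin n, (d ((i : ℕ) + 1) - d i) * y i := by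
        refine Finset.sum_congr rfl fun i _ => ?_
        simp only [hp, d, y, ChoquetGame.increment, i.isLt, dif_pos]
        ring
    _ = ∑ i ∈ Finset.range n, (d (i + 1) - d i) * y i :=
        Fin.sum_univ_eq_sum_range (fun i => (d (i + 1) - d i) * y i) n
    _ = 0 := by
        rw [Finset.sum_congr rfl key, Finset.sum_range_sub (fun i => d i * y i), d0, dn]
        ring

/-- The density formula: on `y ≥ 0` it is
`(1/n!) ∑_σ ∑_i r_i^{n-2} / ∏_{k ≠ i} (r_i - r_k) * exp (-y / r_i)` with `r_i = ν_i^σ / i`, and it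
vanishes on `y < 0`. The exponent `n - 2` is an integer (it is `-1` for `n = 1`). -/
noncomputable def choquetExpDensity {n : ℕ} (ν : ChoquetGame n) (y : ℝ) : ℝ :=
  if 0 ≤ y then
    (1 / (n.factorial : ℝ)) * ∑ σ : Equiv.Perm (Fin n), ∑ i : Fin n,
      ν.ratio σ i ^ ((n : ℤ) - 2) / (∏ k ∈ Finset.univ.erase i, (ν.ratio σ i - ν.ratio σ k)) *
        Real.exp (-y / ν.ratio σ i)
  else 0

/-! Cut `ℝⁿ` into the `n!` cones on which the order of the coordinates is fixed. They overlap only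
in ties, a null set, and on the cone of `σ` the Choquet integral is linear in the sorted
coordinates. By exchangeability every cone reduces to the cone of decreasing vectors. There Rényi's
representation (`restrict_antitone_pi_expMeasure`) gives, in 1-based notation, `x_i = ∑_{j ≥ i} z_j
/ j` with `z` again i.i.d. standard exponential, the cone having mass `1/n!`. Exchanging sums
telescopes the increments of `ν`, so the integral becomes `∑ j, (ν_j^σ / j) z_j`.

Thus `Y_ν` is a uniform mixture over `σ` of sums of independent exponentials with distinct positive
scales. The density of such a sum is found by convolving one exponential at a time
(`lconvolution_hypoexpDensity`); the coefficients close up because of a Lagrange interpolation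
identity (`sum_pow_div_prod_sub_eq_zero`). -/

/-- The density of `∑ i ∈ s, r i * Z i` for independent standard exponential variables `Z i` and
distinct positive scales `r i` (the hypoexponential density). -/
noncomputable def hypoexpDensity {ι : Type*} [DecidableEq ι] (s : Finset ι) (r : ι → ℝ) (y : ℝ) :
    ℝ :=
  if 0 ≤ y then
    ∑ i ∈ s, r i ^ ((s.card : ℤ) - 2) / (∏ k ∈ s.erase i, (r i - r k)) * Real.exp (-y / r i)
  else 0

/-! ### Sums of independent exponentials with distinct scales -/

section Hypoexponential

variable {ι : Type*} [DecidableEq ι]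

theorem measurable_hypoexpDensity (s : Finset ι) (r : ι → ℝ) :
    Measurable (hypoexpDensity s r) := by
  unfold hypoexpDensity
  exact Measurable.ite measurableSet_Ici (by fun_prop) measurable_const

theorem hypoexpDensity_of_neg (s : Finset ι) (r : ι → ℝ) {y : ℝ} (hy : y < 0) :
    hypoexpDensity s r y = 0 := if_neg hy.not_ge

theorem hypoexpDensity_singleton (a : ι) (r : ι → ℝ) (y : ℝ) :
    hypoexpDensity {a} r y = if 0 ≤ y then (r a)⁻¹ * Real.exp (-y / r a) else 0 := by
  simp [hypoexpDensity, show ((1 : ℤ) - 2) = -1 by norm_num]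

/-- By Lagrange interpolation at the nodes `v i`, the sum is the coefficient of degree `s.card - 1`
of `X ^ m`, which has smaller degree. -/
theorem sum_pow_div_prod_sub_eq_zero {F : Type*} [Field F] {s : Finset ι} {v : ι → F}
    (hv : Set.InjOn v s) {m : ℕ} (hm : m + 1 < s.card) :
    ∑ i ∈ s, v i ^ m / ∏ j ∈ s.erase i, (v i - v j) = 0 := by
  have h := Lagrange.coeff_eq_sum hv (P := Polynomial.X ^ m)
    (by rw [Polynomial.degree_X_pow]; exact_mod_cast (by omega : m < s.card))
  simp only [Polynomial.eval_pow, Polynomial.eval_X] at h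
  rw [← h, Polynomial.coeff_X_pow, if_neg (by omega)]

/-- The coefficients of the enlarged density sum to zero, so the one at `a` is minus the sum of the
others. Eliminating it leaves, for each `i ∈ s`, what convolution with the exponential of scale `r
a` makes of the `i`-th term. -/
theorem hypoexpDensity_cons {a : ι} {s : Finset ι} (ha : a ∉ s) (hs : s.Nonempty) {r : ι → ℝ}
    (hinj : Set.InjOn r (Finset.cons a s ha)) (hpos : ∀ i, 0 < r i) {y : ℝ} (hy : 0 ≤ y) :
    hypoexpDensity (Finset.cons a s ha) r y =
      ∑ i ∈ s, r i ^ ((s.card : ℤ) - 2) / (∏ k ∈ s.erase i, (r i - r k)) *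
        (r i / (r a - r i) * (Real.exp (-y / r a) - Real.exp (-y / r i))) := by
  have hne : ∀ i ∈ s, r i - r a ≠ 0 := fun i hi => sub_ne_zero.2 fun h =>
    ha (hinj (by simp [hi]) (by simp) h ▸ hi)
  have hc := s.card_pos.2 hs
  have hcoef : ∀ i ∈ s, r i ^ (((Finset.cons a s ha).card : ℤ) - 2) /
      (∏ k ∈ (Finset.cons a s ha).erase i, (r i - r k)) =
      r i ^ ((s.card : ℤ) - 2) / (∏ k ∈ s.erase i, (r i - r k)) * (r i / (r i - r a)) := by
    intro i hi
    have hia : a ≠ i := fun h => ha (h ▸ hi)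
    rw [Finset.cons_eq_insert, Finset.erase_insert_of_ne hia,
      Finset.prod_insert (fun h => ha (Finset.mem_of_mem_erase h)), Finset.card_insert_of_notMem ha,
      show ((s.card + 1 : ℕ) : ℤ) - 2 = ((s.card : ℤ) - 2) + 1 by push_cast; ring,
      zpow_add_one₀ (hpos i).ne', mul_comm (r i - r a), mul_div_mul_comm]
  -- Nonemptiness of `s` makes the integer exponent a natural number here.
  have hzero := sum_pow_div_prod_sub_eq_zero hinj (m := s.card - 1)
    (by rw [Finset.card_cons]; omega)
  have hexp : (((Finset.cons a s ha).card : ℤ) - 2) = ((s.card - 1 : ℕ) : ℤ) := by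
    rw [Finset.card_cons]; omega
  have hzero' : ∑ i ∈ Finset.cons a s ha, r i ^ (((Finset.cons a s ha).card : ℤ) - 2) /
      (∏ k ∈ (Finset.cons a s ha).erase i, (r i - r k)) = 0 := by
    rw [← hzero]; simp only [hexp, zpow_natCast]
  rw [hypoexpDensity, if_pos hy, Finset.sum_cons]
  rw [Finset.sum_cons, add_eq_zero_iff_eq_neg] at hzero'
  rw [hzero', Finset.sum_congr rfl hcoef,
    Finset.sum_congr rfl fun i hi => congrArg (· * _) (hcoef i hi), neg_mul, Finset.sum_mul,
    ← Finset.sum_neg_distrib, ← Finset.sum_add_distrib]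
  refine Finset.sum_congr rfl fun i hi => ?_
  rw [← neg_sub (r i) (r a), div_neg]
  ring

theorem integral_exp_mul_hypoexpDensity {a : ι} {s : Finset ι} (ha : a ∉ s) (hs : s.Nonempty)
    {r : ι → ℝ} (hinj : Set.InjOn r (Finset.cons a s ha)) (hpos : ∀ i, 0 < r i) {y : ℝ}
    (hy : 0 ≤ y) :
    ∫ x in Set.Icc 0 y, hypoexpDensity {a} r x * hypoexpDensity s r (-x + y) =
      hypoexpDensity (Finset.cons a s ha) r y := by
  have hne : ∀ i ∈ s, r a - r i ≠ 0 := fun i hi => sub_ne_zero.2 fun h =>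
    ha (hinj (by simp) (by simp [hi]) h ▸ hi)
  set c : ι → ℝ := fun i => r i ^ ((s.card : ℤ) - 2) / (∏ k ∈ s.erase i, (r i - r k)) with hc
  have h1 : ∀ x ∈ Set.Icc 0 y, hypoexpDensity {a} r x * hypoexpDensity s r (-x + y) =
      (r a)⁻¹ * Real.exp (-x / r a) * ∑ i ∈ s, c i * Real.exp (-(-x + y) / r i) := by
    intro x hx
    rw [hypoexpDensity_singleton, if_pos hx.1, hypoexpDensity, if_pos (by linarith [hx.2])]
  rw [setIntegral_congr_fun measurableSet_Icc h1, integral_Icc_eq_integral_Ioc,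
    ← intervalIntegral.integral_of_le hy, hypoexpDensity_cons ha hs hinj hpos hy,
    -- The product of exponentials grows at rate `1 / r i - 1 / r a`; dividing `(r a)⁻¹` by this
    -- rate gives `r i / (r a - r i)`.
    intervalIntegral.integral_eq_sub_of_hasDerivAt (f := fun x => ∑ i ∈ s, c i *
      (r i / (r a - r i) * (Real.exp (-x / r a) * Real.exp (-(-x + y) / r i))))]
  · rw [← Finset.sum_sub_distrib]
    refine Finset.sum_congr rfl fun i hi => ?_
    simp
    ring
  · intro x _
    rw [Finset.mul_sum]
    refine HasDerivAt.fun_sum fun i hi => ?_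
    have e1 : HasDerivAt (fun x : ℝ => Real.exp (-x / r a))
        (Real.exp (-x / r a) * (-1 / r a)) x := ((hasDerivAt_id x).neg.div_const (r a)).exp
    have e2 : HasDerivAt (fun x : ℝ => Real.exp (-(-x + y) / r i))
        (Real.exp (-(-x + y) / r i) * (- -1 / r i)) x :=
      (((hasDerivAt_id x).neg.add_const y).neg.div_const (r i)).exp
    refine (((e1.mul e2).const_mul _).const_mul (c i)).congr_deriv ?_
    have := hne i hi
    have := (hpos a).ne'
    have := (hpos i).ne'
    field_simp
    ring
  · exact Continuous.intervalIntegrable (by fun_prop) _ _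

/-- The coefficients have mixed signs, so positivity is not visible termwise; it is inherited from
the convolution integral by induction. -/
theorem hypoexpDensity_nonneg {s : Finset ι} (hs : s.Nonempty) {r : ι → ℝ}
    (hinj : Set.InjOn r s) (hpos : ∀ i, 0 < r i) (y : ℝ) : 0 ≤ hypoexpDensity s r y := by
  have single : ∀ a x, 0 ≤ hypoexpDensity {a} r x := fun a x => by
    have := hpos a
    rw [hypoexpDensity_singleton]; positivity
  induction hs using Finset.Nonempty.cons_induction generalizing y with
  | singleton a => exact single a y
  | cons a s ha hs ih =>
    rcases lt_or_ge y 0 with hy | hy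
    · exact (hypoexpDensity_of_neg _ _ hy).ge
    · rw [← integral_exp_mul_hypoexpDensity ha hs hinj hpos hy]
      exact integral_nonneg fun x => mul_nonneg (single a x)
        (ih (hinj.mono (by simp)) _)

theorem lconvolution_hypoexpDensity {a : ι} {s : Finset ι} (ha : a ∉ s) (hs : s.Nonempty)
    {r : ι → ℝ} (hinj : Set.InjOn r (Finset.cons a s ha)) (hpos : ∀ i, 0 < r i) :
    lconvolution (fun y => ENNReal.ofReal (hypoexpDensity {a} r y))
      (fun y => ENNReal.ofReal (hypoexpDensity s r y)) volume =
      fun y => ENNReal.ofReal (hypoexpDensity (Finset.cons a s ha) r y) := by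
  have single : ∀ x, 0 ≤ hypoexpDensity {a} r x :=
    hypoexpDensity_nonneg (Finset.singleton_nonempty a) (by simp) hpos
  have hsn := hypoexpDensity_nonneg hs (hinj.mono (by simp)) hpos
  ext y
  simp only [lconvolution_def, ← ENNReal.ofReal_mul (single _)]
  have hout : ∀ x, x ∉ Set.Icc 0 y →
      hypoexpDensity {a} r x * hypoexpDensity s r (-x + y) = 0 := by
    intro x hx
    rcases lt_or_ge x 0 with h | h
    · rw [hypoexpDensity_of_neg _ _ h, zero_mul]
    · rw [hypoexpDensity_of_neg s _ (y := -x + y), mul_zero]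
      by_contra h'
      exact hx ⟨h, by linarith⟩
  rcases lt_or_ge y 0 with hy | hy
  · rw [hypoexpDensity_of_neg _ _ hy, ENNReal.ofReal_zero]
    refine lintegral_eq_zero_of_ae_eq_zero (Filter.Eventually.of_forall fun x => ?_)
    simp [hout x (by simp [hy])]
  · rw [← integral_exp_mul_hypoexpDensity ha hs hinj hpos hy,
      ofReal_integral_eq_lintegral_ofReal _
        (Filter.Eventually.of_forall fun x => mul_nonneg (single _) (hsn _)),
      ← lintegral_indicator measurableSet_Icc]
    · congr 1 with x
      by_cases hx : x ∈ Set.Icc 0 y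
      · rw [Set.indicator_of_mem hx]
      · rw [Set.indicator_of_notMem hx, hout x hx, ENNReal.ofReal_zero]
    · have h1 : Set.EqOn (fun x => (r a)⁻¹ * Real.exp (-x / r a) * ∑ i ∈ s,
          r i ^ ((s.card : ℤ) - 2) / (∏ k ∈ s.erase i, (r i - r k)) *
            Real.exp (-(-x + y) / r i))
          (fun x => hypoexpDensity {a} r x * hypoexpDensity s r (-x + y)) (Set.Icc 0 y) := by
        intro x hx
        simp only
        rw [hypoexpDensity_singleton, if_pos hx.1, hypoexpDensity, if_pos (by linarith [hx.2])]
      exact (integrableOn_congr_fun h1 measurableSet_Icc).1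
        (Continuous.integrableOn_Icc (by fun_prop))

theorem map_withDensity_comp {α β : Type*} [MeasurableSpace α] [MeasurableSpace β]
    {μ : Measure α} {T : α → β} (hT : Measurable T) {g : β → ENNReal} (hg : Measurable g) :
    (μ.withDensity (g ∘ T)).map T = (μ.map T).withDensity g := by
  ext A hA
  rw [Measure.map_apply hT hA, withDensity_apply _ (hT hA), withDensity_apply _ hA,
    setLIntegral_map hA hg hT]
  rfl

theorem map_const_mul_expMeasure (a : ι) {r : ι → ℝ} (hr : 0 < r a) :
    (expMeasure 1).map (fun x => r a * x) =
      volume.withDensity fun y => ENNReal.ofReal (hypoexpDensity {a} r y) := by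
  -- The density is written as a function of `r a * x`; the factor `r a` will cancel the Jacobian of
  -- the scaling.
  have hd : expMeasure 1 = volume.withDensity
      ((fun y => ENNReal.ofReal (r a) * ENNReal.ofReal (hypoexpDensity {a} r y)) ∘
        fun x => r a * x) := by
    change volume.withDensity (exponentialPDF 1) = _
    congr 1 with x
    rw [exponentialPDF_eq, Function.comp_apply, ← ENNReal.ofReal_mul hr.le,
      hypoexpDensity_singleton]
    simp only [mul_nonneg_iff_of_pos_left hr]
    split_ifs
    · congr 1
      field_simp
    · simp
  have hm := (measurable_hypoexpDensity {a} r).ennreal_ofReal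
  rw [hd, map_withDensity_comp (by fun_prop) (by fun_prop), Real.map_volume_mul_left hr.ne',
    withDensity_smul_measure, ← withDensity_smul _ (by fun_prop)]
  congr 1 with y
  rw [Pi.smul_apply, smul_eq_mul, ← mul_assoc, ← ENNReal.ofReal_mul (abs_nonneg _),
    abs_of_pos (inv_pos.2 hr), inv_mul_cancel₀ hr.ne', ENNReal.ofReal_one, one_mul]

theorem map_sum_const_mul_pi_expMeasure [Fintype ι] {s : Finset ι} (hs : s.Nonempty) {r : ι → ℝ}
    (hinj : Set.InjOn r s) (hpos : ∀ i, 0 < r i) :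
    (Measure.pi fun _ : ι => expMeasure 1).map (∑ i ∈ s, fun z => r i * z i) =
      volume.withDensity fun y => ENNReal.ofReal (hypoexpDensity s r y) := by
  have := isProbabilityMeasure_expMeasure one_pos
  have single : ∀ a, (Measure.pi fun _ : ι => expMeasure 1).map (fun z => r a * z a) =
      volume.withDensity fun y => ENNReal.ofReal (hypoexpDensity {a} r y) := fun a => by
    rw [← map_const_mul_expMeasure a (hpos a)]
    conv_rhs => rw [← (measurePreserving_eval (fun _ : ι => expMeasure 1) a).map_eq,
      Measure.map_map (by fun_prop) (by fun_prop)]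
    rfl
  induction hs using Finset.Nonempty.cons_induction with
  | singleton a => rw [Finset.sum_singleton, single]
  | cons a s ha hs ih =>
    have hind : iIndepFun (fun i (z : ι → ℝ) => r i * z i)
        (Measure.pi fun _ : ι => expMeasure 1) :=
      iIndepFun_pi (X := fun i x => r i * x) fun i => by fun_prop
    rw [Finset.sum_cons, IndepFun.map_add_eq_map_conv_map (f := fun z => r a * z a)
      (g := ∑ i ∈ s, fun z : ι → ℝ => r i * z i) (by fun_prop)
      (by rw [Finset.sum_fn]; fun_prop)
      (hind.indepFun_finsetSum_of_notMem (fun i => by fun_prop) ha).symm, single,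
      ih (hinj.mono (by simp)), conv_withDensity_eq_lconvolution
        (measurable_hypoexpDensity _ _).ennreal_ofReal
        (measurable_hypoexpDensity _ _).ennreal_ofReal, lconvolution_hypoexpDensity ha hs hinj hpos]

end Hypoexponential

/-! ### Normalized spacings and Rényi's representation -/

section Spacings

theorem lintegral_pi_fin_prod_eq_prod {E : Type*} [MeasurableSpace E] (n : ℕ)
    (μ : Measure E) [SigmaFinite μ] (f : Fin n → E → ENNReal) (hf : ∀ i, Measurable (f i)) :
    ∫⁻ x, ∏ i, f i (x i) ∂(Measure.pi fun _ : Fin n => μ) = ∏ i, ∫⁻ t, f i t ∂μ := by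
  induction n with
  | zero => simp
  | succ n ih =>
    rw [Fin.prod_univ_succ, ← ih _ fun i => hf i.succ,
      ← lintegral_prod_mul (hf 0).aemeasurable
        (Finset.measurable_prod _ fun i _ => (hf i.succ).comp (measurable_pi_apply i)).aemeasurable,
      ← (measurePreserving_piFinSuccAbove (fun _ : Fin (n + 1) => μ) 0).symm.lintegral_comp_emb
        (MeasurableEquiv.measurableEmbedding _)]
    simp [MeasurableEquiv.piFinSuccAbove_symm_apply, Fin.insertNthEquiv, Fin.prod_univ_succ]

theorem pi_withDensity_fin {E : Type*} [MeasurableSpace E] (n : ℕ) (μ : Measure E) [SigmaFinite μ]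
    {f : E → ENNReal} (hf : Measurable f) [SigmaFinite (μ.withDensity f)] :
    (Measure.pi fun _ : Fin n => μ.withDensity f) =
      (Measure.pi fun _ : Fin n => μ).withDensity fun x => ∏ i, f (x i) := by
  refine Measure.pi_eq fun A hA => ?_
  rw [withDensity_apply _ (MeasurableSet.univ_pi hA),
    ← lintegral_indicator (MeasurableSet.univ_pi hA)]
  simp_rw [withDensity_apply _ (hA _), ← lintegral_indicator (hA _)]
  rw [← lintegral_pi_fin_prod_eq_prod n μ _ fun i => hf.indicator (hA i)]
  congr 1 with x
  by_cases hx : ∀ i, x i ∈ A i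
  · rw [Set.indicator_of_mem (by simpa using hx)]
    exact Finset.prod_congr rfl fun i _ => (Set.indicator_of_mem (hx i) f).symm
  · rw [Set.indicator_of_notMem (by simpa using hx)]
    push Not at hx
    obtain ⟨i, hi⟩ := hx
    exact (Finset.prod_eq_zero (Finset.mem_univ i) (Set.indicator_of_notMem hi f)).symm

/-- The joint density of independent standard exponential variables. -/
noncomputable def piExpDensity {n : ℕ} : (Fin n → ℝ) → ENNReal :=
  Set.indicator {x | ∀ i, 0 ≤ x i} fun x => ENNReal.ofReal (Real.exp (-∑ i, x i))

theorem measurableSet_forall_nonneg {n : ℕ} : MeasurableSet {x : Fin n → ℝ | ∀ i, 0 ≤ x i} := by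
  rw [Set.ofPred_forall]
  exact MeasurableSet.iInter fun i => measurableSet_le measurable_const (measurable_pi_apply i)

theorem measurableSet_antitone {n : ℕ} : MeasurableSet {x : Fin n → ℝ | Antitone x} :=
  isClosed_antitone.measurableSet

theorem measurable_piExpDensity {n : ℕ} : Measurable (piExpDensity (n := n)) :=
  Measurable.indicator (by fun_prop) measurableSet_forall_nonneg

theorem pi_expMeasure_eq_withDensity (n : ℕ) :
    (Measure.pi fun _ : Fin n => expMeasure 1) = volume.withDensity piExpDensity := by
  have := isProbabilityMeasure_expMeasure one_pos
  have h : Measurable (exponentialPDF 1) := (measurable_exponentialPDFReal 1).ennreal_ofReal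
  have : SigmaFinite ((volume : Measure ℝ).withDensity (exponentialPDF 1)) :=
    inferInstanceAs (SigmaFinite (expMeasure 1))
  change (Measure.pi fun _ : Fin n => volume.withDensity (exponentialPDF 1)) = _
  rw [pi_withDensity_fin n volume h, ← volume_pi]
  congr 1 with x
  by_cases hx : ∀ i, 0 ≤ x i
  · rw [piExpDensity, Set.indicator_of_mem (show x ∈ {x : Fin n → ℝ | ∀ i, 0 ≤ x i} from hx),
      ← Finset.sum_neg_distrib, Real.exp_sum,
      ENNReal.ofReal_prod_of_nonneg fun i _ => (Real.exp_pos _).le]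
    refine Finset.prod_congr rfl fun i _ => ?_
    rw [exponentialPDF_of_nonneg (hx i), one_mul, one_mul]
  · rw [piExpDensity, Set.indicator_of_notMem (show x ∉ {x : Fin n → ℝ | ∀ i, 0 ≤ x i} from hx)]
    push Not at hx
    obtain ⟨i, hi⟩ := hx
    exact Finset.prod_eq_zero (Finset.mem_univ i) (exponentialPDF_of_neg hi)

/-- The matrix of the map `z ↦ (∑ j ≥ i, z j / (j + 1))ᵢ` sending normalized spacings to the
decreasing order statistics. -/
noncomputable def spacingMatrix (n : ℕ) : Matrix (Fin n) (Fin n) ℝ :=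
  Matrix.of fun i j => if i ≤ j then ((j : ℝ) + 1)⁻¹ else 0

theorem det_spacingMatrix (n : ℕ) : (spacingMatrix n).det = ((n.factorial : ℝ))⁻¹ := by
  rw [Matrix.det_of_isUpperTriangular]
  · simp only [spacingMatrix, Matrix.of_apply, le_refl, if_true, Finset.prod_inv_distrib]
    rw [Fin.prod_univ_eq_prod_range (fun i => (i : ℝ) + 1) n,
      ← Finset.prod_range_add_one_eq_factorial]
    push_cast
    rfl
  · intro i j hij
    exact if_neg (not_le.2 hij)

theorem spacingMatrix_apply {n : ℕ} (z : Fin n → ℝ) (i : Fin n) :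
    (spacingMatrix n).toLin' z i = ∑ j ∈ Finset.Ici i, z j / ((j : ℝ) + 1) := by
  rw [Matrix.toLin'_apply, Matrix.mulVec, dotProduct, ← Finset.filter_le_eq_Ici, Finset.sum_filter]
  refine Finset.sum_congr rfl fun j _ => ?_
  simp only [spacingMatrix, Matrix.of_apply]
  split_ifs
  · rw [mul_comm, div_eq_mul_inv]
  · rw [zero_mul]

theorem sum_mul_spacingMatrix {n : ℕ} (w z : Fin n → ℝ) :
    ∑ i, w i * (spacingMatrix n).toLin' z i =
      ∑ j, (∑ i ∈ Finset.Iic j, w i) / ((j : ℝ) + 1) * z j := by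
  simp_rw [spacingMatrix_apply, Finset.mul_sum]
  rw [Finset.sum_comm' (t' := Finset.univ) (s' := fun j => Finset.Iic j) (by simp)]
  refine Finset.sum_congr rfl fun j _ => ?_
  rw [← Finset.sum_mul]
  ring

theorem sum_spacingMatrix {n : ℕ} (z : Fin n → ℝ) :
    ∑ i, (spacingMatrix n).toLin' z i = ∑ j, z j := by
  have h := sum_mul_spacingMatrix (fun _ => 1) z
  simp only [one_mul] at h
  rw [h]
  refine Finset.sum_congr rfl fun j _ => ?_
  have : (j : ℝ) + 1 ≠ 0 := by positivity
  simp [Fin.card_Iic, this]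

/-- Each `z i / (i + 1)` is the gap between consecutive coordinates of the image, the last one being
the gap to zero. -/
theorem antitone_nonneg_spacingMatrix_iff {n : ℕ} (z : Fin n → ℝ) :
    (Antitone ((spacingMatrix n).toLin' z) ∧ ∀ i, 0 ≤ (spacingMatrix n).toLin' z i) ↔
      ∀ i, 0 ≤ z i := by
  constructor
  · rintro ⟨ha, hn⟩ i
    have hsplit : (spacingMatrix n).toLin' z i =
        z i / ((i : ℝ) + 1) + ∑ j ∈ Finset.Ioi i, z j / ((j : ℝ) + 1) := by
      rw [spacingMatrix_apply, ← Finset.Ioi_insert, Finset.sum_insert (by simp)]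
    have hle : ∑ j ∈ Finset.Ioi i, z j / ((j : ℝ) + 1) ≤ (spacingMatrix n).toLin' z i := by
      by_cases h : (i : ℕ) + 1 < n
      · have : Finset.Ioi i = Finset.Ici ⟨i + 1, h⟩ := by
          ext j
          rw [Finset.mem_Ioi, Finset.mem_Ici, Fin.lt_def, Fin.le_def, Nat.succ_le_iff]
        rw [this, ← spacingMatrix_apply]
        exact ha (Fin.le_def.2 (Nat.le_succ _))
      · have : Finset.Ioi i = ∅ := by
          ext j
          simp only [Finset.mem_Ioi, Fin.lt_def, Finset.notMem_empty, iff_false]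
          omega
        rw [this, Finset.sum_empty]
        exact hn i
    have : 0 ≤ z i / ((i : ℝ) + 1) := by linarith
    exact (div_nonneg_iff.1 this).elim (·.1) fun h => absurd h.2 (by push Not; positivity)
  · intro hz
    have h0 : ∀ j : Fin n, 0 ≤ z j / ((j : ℝ) + 1) := fun j => div_nonneg (hz j) (by positivity)
    refine ⟨fun i j hij => ?_, fun i => ?_⟩
    · rw [spacingMatrix_apply, spacingMatrix_apply]
      exact Finset.sum_le_sum_of_subset_of_nonneg (Finset.Ici_subset_Ici.2 hij) fun k _ _ => h0 k
    · rw [spacingMatrix_apply]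
      exact Finset.sum_nonneg fun k _ => h0 k

theorem measurable_spacingMatrix (n : ℕ) : Measurable (spacingMatrix n).toLin' :=
  (LinearMap.continuous_of_finiteDimensional _).measurable

/-- Rényi's representation: on the event that the coordinates are decreasing, independent standard
exponential variables are the image of independent standard exponential normalized spacings. -/
theorem restrict_antitone_pi_expMeasure (n : ℕ) :
    (Measure.pi fun _ : Fin n => expMeasure 1).restrict {x | Antitone x} =
      (n.factorial : ENNReal)⁻¹ •
        (Measure.pi fun _ : Fin n => expMeasure 1).map (spacingMatrix n).toLin' := by
  -- The density depends only on the coordinate sum and on membership in the orthant. The map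
  -- preserves the sum and matches the orthant with the decreasing nonnegative vectors, so only its
  -- determinant `1 / n!` matters.
  have hcomp : piExpDensity (n := n) =
      Set.indicator {x | Antitone x} piExpDensity ∘ (spacingMatrix n).toLin' := by
    ext z
    have h := antitone_nonneg_spacingMatrix_iff z
    rw [Function.comp_apply, piExpDensity, Set.indicator_indicator]
    by_cases hz : ∀ i, 0 ≤ z i
    · rw [Set.indicator_of_mem (show z ∈ {x : Fin n → ℝ | ∀ i, 0 ≤ x i} from hz),
        Set.indicator_of_mem (show (spacingMatrix n).toLin' z ∈ _ ∩ _ from h.2 hz),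
        sum_spacingMatrix]
    · rw [Set.indicator_of_notMem (show z ∉ {x : Fin n → ℝ | ∀ i, 0 ≤ x i} from hz),
        Set.indicator_of_notMem (show (spacingMatrix n).toLin' z ∉ _ ∩ _ from fun h' => hz (h.1 h'))]
  have hdet : (spacingMatrix n).det ≠ 0 := by
    rw [det_spacingMatrix]
    positivity
  rw [pi_expMeasure_eq_withDensity]
  conv_rhs => rw [hcomp]
  rw [map_withDensity_comp (measurable_spacingMatrix n)
    (measurable_piExpDensity.indicator measurableSet_antitone),
    Real.map_matrix_volume_pi_eq_smul_volume_pi hdet, withDensity_smul_measure,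
    withDensity_indicator measurableSet_antitone, ← restrict_withDensity measurableSet_antitone,
    smul_smul, det_spacingMatrix, inv_inv, abs_of_nonneg (by positivity), ENNReal.ofReal_natCast,
    ENNReal.inv_mul_cancel (by exact_mod_cast n.factorial_ne_zero) (ENNReal.natCast_ne_top _),
    one_smul]

end Spacings

/-! ### The Choquet integral on the ordering cones -/

section Choquet

variable {n : ℕ}

theorem ChoquetGame.sum_increment_Iic (ν : ChoquetGame n) (σ : Equiv.Perm (Fin n)) (j : Fin n) :
    ∑ i ∈ Finset.Iic j, ν.increment σ i = ν.partialValue σ ((j : ℕ) + 1) := by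
  have h0 : ν.partialValue σ 0 = 0 := by simp [ChoquetGame.partialValue, ν.map_empty]
  have h := Finset.sum_range_sub (ν.partialValue σ) ((j : ℕ) + 1)
  rw [h0, sub_zero] at h
  rw [← h]
  refine Finset.sum_bij (fun i _ => (i : ℕ)) (fun i hi => ?_) (fun i _ k _ h => Fin.ext h)
    (fun b hb => ?_) fun i _ => rfl
  · exact Finset.mem_range.2 (Nat.lt_succ_of_le (Fin.le_def.1 (Finset.mem_Iic.1 hi)))
  · have hb' := Finset.mem_range.1 hb
    exact ⟨⟨b, by omega⟩, Finset.mem_Iic.2 (Fin.le_def.2 (Nat.lt_succ_iff.1 hb')), rfl⟩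

theorem sum_increment_mul_spacingMatrix (ν : ChoquetGame n) (σ : Equiv.Perm (Fin n))
    (z : Fin n → ℝ) :
    ∑ i, ν.increment σ i * (spacingMatrix n).toLin' z i = ∑ j, ν.ratio σ j * z j := by
  simp_rw [sum_mul_spacingMatrix, ν.sum_increment_Iic, ChoquetGame.ratio]

theorem measurableSet_antitone_comp (σ : Equiv.Perm (Fin n)) :
    MeasurableSet {x : Fin n → ℝ | Antitone (x ∘ σ)} :=
  measurableSet_antitone.preimage (f := fun x : Fin n → ℝ => x ∘ σ)
    (measurable_pi_lambda _ fun i => measurable_pi_apply (σ i))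

theorem measurable_choquet (ν : ChoquetGame n) : Measurable (choquet ν) := by
  intro A hA
  -- A finite union over the cones avoids any measurability claim about the sorting permutation.
  have : choquet ν ⁻¹' A = ⋃ σ : Equiv.Perm (Fin n), {x | Antitone (x ∘ σ)} ∩
      (fun x => ∑ i, ν.increment σ i * x (σ i)) ⁻¹' A := by
    ext x
    simp only [Set.mem_preimage, Set.mem_iUnion, Set.mem_inter_iff, Set.mem_ofPred_eq]
    constructor
    · exact fun h => ⟨decreasingPerm x, antitone_comp_decreasingPerm x, h⟩
    · rintro ⟨σ, hσ, h⟩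
      rwa [choquet_eq ν x σ hσ]
  rw [this]
  refine MeasurableSet.iUnion fun σ => (measurableSet_antitone_comp σ).inter ?_
  exact (show Measurable fun x : Fin n → ℝ => ∑ i, ν.increment σ i * x (σ i) by fun_prop) hA

theorem map_comp_perm_pi_expMeasure (σ : Equiv.Perm (Fin n)) :
    (Measure.pi fun _ : Fin n => expMeasure 1).map (fun x => x ∘ σ) =
      Measure.pi fun _ : Fin n => expMeasure 1 := by
  have := isProbabilityMeasure_expMeasure one_pos
  have hind : iIndepFun (fun i (z : Fin n → ℝ) => z i) (Measure.pi fun _ => expMeasure 1) :=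
    iIndepFun_pi (X := fun _ x => x) fun i => by fun_prop
  exact (iIndepFun.hasLaw_pi (fun i => (measurePreserving_eval (fun _ : Fin n => expMeasure 1)
    (σ i)).hasLaw) (hind.precomp σ.injective)).map_eq

theorem pi_expMeasure_setOf_eq {a b : Fin n} (hab : a ≠ b) :
    (Measure.pi fun _ : Fin n => expMeasure 1) {x | x a = x b} = 0 := by
  rw [pi_expMeasure_eq_withDensity]
  refine withDensity_absolutelyContinuous _ _ ?_
  -- Ties lie in a proper subspace, which is Lebesgue null.
  let S : Submodule ℝ (Fin n → ℝ) := LinearMap.eqLocus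
    (LinearMap.proj (R := ℝ) (φ := fun _ : Fin n => ℝ) a) (LinearMap.proj b)
  refine Measure.addHaar_submodule volume S fun h => ?_
  have : Pi.single a (1 : ℝ) ∈ S := h ▸ Submodule.mem_top
  simp [S, hab.symm] at this

theorem pi_expMeasure_eq_sum_restrict :
    (Measure.pi fun _ : Fin n => expMeasure 1) = Measure.sum fun σ : Equiv.Perm (Fin n) =>
      (Measure.pi fun _ : Fin n => expMeasure 1).restrict {x | Antitone (x ∘ σ)} := by
  rw [← Measure.restrict_iUnion_ae _ fun σ => (measurableSet_antitone_comp σ).nullMeasurableSet]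
  · rw [Set.iUnion_eq_univ_iff.2 fun x => ⟨_, antitone_comp_decreasingPerm x⟩,
      Measure.restrict_univ]
  · intro σ τ hστ
    obtain ⟨i, hi⟩ : ∃ i, σ i ≠ τ i := by
      by_contra! h
      exact hστ (Equiv.ext h)
    exact measure_mono_null
      (fun x hx => congrFun (Tuple.unique_antitone (f := x) hx.1 hx.2) i)
      (pi_expMeasure_setOf_eq hi)

theorem map_choquet_restrict (hn : 1 ≤ n) (ν : ChoquetGame n) (σ : Equiv.Perm (Fin n))
    (hinj : Function.Injective (ν.ratio σ)) (hpos : ∀ i, 0 < ν.ratio σ i) :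
    ((Measure.pi fun _ : Fin n => expMeasure 1).restrict {x | Antitone (x ∘ σ)}).map (choquet ν) =
      (n.factorial : ENNReal)⁻¹ • volume.withDensity fun y =>
        ENNReal.ofReal (hypoexpDensity Finset.univ (ν.ratio σ) y) := by
  have hσ : Measurable fun x : Fin n → ℝ => x ∘ σ :=
    measurable_pi_lambda _ fun i => measurable_pi_apply (σ i)
  have hL : Measurable fun x : Fin n → ℝ => ∑ i, ν.increment σ i * x i := by fun_prop
  have hcongr : choquet ν =ᵐ[(Measure.pi fun _ : Fin n => expMeasure 1).restrict
      {x | Antitone (x ∘ σ)}] (fun x => ∑ i, ν.increment σ i * x i) ∘ fun x => x ∘ σ :=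
    (ae_restrict_mem (measurableSet_antitone_comp σ)).mono fun x hx => choquet_eq ν x σ hx
  have : Nonempty (Fin n) := ⟨⟨0, hn⟩⟩
  rw [Measure.map_congr hcongr, ← Measure.map_map hL hσ]
  -- The cone of `σ` is the preimage of the decreasing cone under `x ↦ x ∘ σ`, which preserves the
  -- product law.
  change Measure.map _ (Measure.map _ (Measure.restrict _ ((fun x => x ∘ σ) ⁻¹' {x | Antitone x})))
    = _
  rw [← Measure.restrict_map hσ measurableSet_antitone, map_comp_perm_pi_expMeasure,
    restrict_antitone_pi_expMeasure, Measure.map_smul,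
    Measure.map_map hL (measurable_spacingMatrix n),
    ← map_sum_const_mul_pi_expMeasure Finset.univ_nonempty hinj.injOn hpos]
  congr 2
  ext z
  simp [Finset.sum_apply, ← sum_increment_mul_spacingMatrix]

theorem choquetExpDensity_eq (ν : ChoquetGame n) (y : ℝ) :
    choquetExpDensity ν y = ∑ σ : Equiv.Perm (Fin n),
      (n.factorial : ℝ)⁻¹ * hypoexpDensity Finset.univ (ν.ratio σ) y := by
  unfold choquetExpDensity hypoexpDensity
  split_ifs
  · rw [one_div, Finset.mul_sum, Finset.card_univ, Fintype.card_fin]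
  · simp

theorem map_choquet_pi_expMeasure (hn : 1 ≤ n) (ν : ChoquetGame n)
    (hinj : ∀ σ, Function.Injective (ν.ratio σ)) (hpos : ∀ σ i, 0 < ν.ratio σ i) :
    (Measure.pi fun _ : Fin n => expMeasure 1).map (choquet ν) =
      volume.withDensity fun y => ENNReal.ofReal (choquetExpDensity ν y) := by
  have : Nonempty (Fin n) := ⟨⟨0, hn⟩⟩
  have hm := fun σ => (measurable_hypoexpDensity Finset.univ (ν.ratio σ)).ennreal_ofReal
  rw [pi_expMeasure_eq_sum_restrict, Measure.map_sum (measurable_choquet ν).aemeasurable]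
  simp_rw [map_choquet_restrict hn ν _ (hinj _) (hpos _), ← withDensity_smul _ (hm _)]
  rw [← withDensity_tsum fun σ => (hm σ).const_smul _]
  congr 1 with y
  rw [tsum_fintype, Finset.sum_apply, choquetExpDensity_eq, ENNReal.ofReal_sum_of_nonneg]
  · refine Finset.sum_congr rfl fun σ _ => ?_
    rw [Pi.smul_apply, smul_eq_mul, ENNReal.ofReal_mul (by positivity),
      ENNReal.ofReal_inv_of_pos (by positivity), ENNReal.ofReal_natCast]
  · exact fun σ _ => mul_nonneg (by positivity)
      (hypoexpDensity_nonneg Finset.univ_nonempty (hinj σ).injOn (hpos σ) y)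

end Choquet

theorem mainTheorem5 {Ω : Type*} [MeasurableSpace Ω] (P : Measure Ω) [IsProbabilityMeasure P]
    (n : ℕ) (hn : 1 ≤ n) (ν : ChoquetGame n)
    (X : Fin n → Ω → ℝ) (hindep : iIndepFun X P)
    (hlaw : ∀ i, HasLaw (X i) (expMeasure 1) P)
    (hne : ∀ (σ : Equiv.Perm (Fin n)) (i k : Fin n), i ≠ k → ν.ratio σ i ≠ ν.ratio σ k)
    (hpos : ∀ (σ : Equiv.Perm (Fin n)) (i : Fin n), 0 < ν.ratio σ i) :
    (∀ y : ℝ, 0 ≤ choquetExpDensity ν y) ∧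
    HasPDF (fun ω => choquet ν (fun i => X i ω)) P volume ∧
    pdf (fun ω => choquet ν (fun i => X i ω)) P volume
      =ᵐ[volume] fun y => ENNReal.ofReal (choquetExpDensity ν y) := by
  have : Nonempty (Fin n) := ⟨⟨0, hn⟩⟩
  have hinj : ∀ σ, Function.Injective (ν.ratio σ) := fun σ i k h => by
    by_contra hik
    exact hne σ i k hik h
  have hmeas : AEMeasurable (fun y => ENNReal.ofReal (choquetExpDensity ν y)) volume := by
    simp_rw [choquetExpDensity_eq]
    exact (Finset.measurable_sum _ fun σ _ =>
      (measurable_hypoexpDensity _ _).const_mul _).ennreal_ofReal.aemeasurable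
  have hXlaw := iIndepFun.hasLaw_pi hlaw hindep
  have hmap : P.map (fun ω => choquet ν (fun i => X i ω)) =
      volume.withDensity fun y => ENNReal.ofReal (choquetExpDensity ν y) := by
    rw [← map_choquet_pi_expMeasure hn ν hinj hpos, ← hXlaw.map_eq,
      AEMeasurable.map_map_of_aemeasurable (measurable_choquet ν).aemeasurable hXlaw.aemeasurable]
    rfl
  have hpdf : HasPDF (fun ω => choquet ν (fun i => X i ω)) P volume :=
    hasPDF_of_map_eq_withDensity
      ((measurable_choquet ν).comp_aemeasurable hXlaw.aemeasurable) _ hmeas hmap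
  refine ⟨fun y => ?_, hpdf, (pdf.eq_of_map_eq_withDensity _ hmeas).1 hmap⟩
  rw [choquetExpDensity_eq]
  exact Finset.sum_nonneg fun σ _ => mul_nonneg (by positivity)
    (hypoexpDensity_nonneg Finset.univ_nonempty (hinj σ).injOn (hpos σ) y)
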